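/- Let $\mathcal{C}$ be an extensive category (with finite coproducts) that has finite limits. Suppose that every object $X$ of $\mathcal{C}$ has a parametrized list object, that is, an object $L(X)$ with arrows $\varnothing : 1 \to L(X)$ and $\mathrm{cons} : X \times L(X) \to L(X)$ such that for all arrows $g : A \to B$ and $h : X \times B \to B$ there is a unique $f : A \times L(X) \to B$ with $f(a,\varnothing) = g(a)$ and $f(a,\mathrm{cons}(x,\ell)) = h(x,f(a,\ell))$ (equations between arrows of $\mathcal{C}$, written with generalized elements). Choose such list objects and let $L : \mathcal{C} \to \mathcal{C}$ be the list object functor, where for $u : X \to Y$ the arrow $L(u)$ is determined by $L(u)(\varnothing) = \varnothing$ and $L(u)(\mathrm{cons}(x,\ell)) = \mathrm{cons}(u(x), L(u)(\ell))$. Let $N = L(1)$, the natural numbers object with $0 = \varnothing$ and $s(n) = \mathrm{cons}(*,n)$. Let $P : N \to N$ be given by $P(0)=0$, $P(s(n)) = n$, let $\dot{-} : N \times N \to N$ be given by $m \mathbin{\dot{-}} 0 = m$, $m \mathbin{\dot{-}} s(n) = P(m \mathbin{\dot{-}} n)$, let $E = \{(m,n) : m < n\}$ be the equalizer of the arrows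 $(m,n) \mapsto s(m) \mathbin{\dot{-}} n$ and $(m,n) \mapsto 0$ from $N \times N$ to $N$, and let $\pi_2^E : E \to N$ be the second projection. Then $\pi_2^E$ is exponentiable, i.e. the pullback functor $\Delta_{\pi_2^E} : \mathcal{C}/N \to \mathcal{C}/E$ has a right adjoint $\Pi_{\pi_2^E}$, and $L$ is a polynomial functor, represented by the polynomial $$1 \longleftarrow E \xrightarrow{\ \pi_2^E\ } N \longrightarrow 1 .$$ That is, under the usual identification of $\mathcal{C}$ with $\mathcal{C}/1$, the functor $L$ is naturally isomorphic to the composite $$\mathcal{C}/1 \xrightarrow{\ \Delta\ } \mathcal{C}/E \xrightarrow{\ \Pi_{\pi_2^E}\ } \mathcal{C}/N \xrightarrow{\ \Sigma\ } \mathcal{C}/1 ,$$ where $\Delta$ is pullback along $E \to 1$ and $\Sigma$ is composition with $N \to 1$. -/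

import Mathlib

open CategoryTheory CategoryTheory.Limits MonoidalCategory CartesianMonoidalCategory

universe v u

namespace LocosPoly

variable {C : Type u} [Category.{v} C] [CartesianMonoidalCategory C]

/-- A (parametrized) list object on `X`. In terms of generalized elements, the two equations that
determine `f` are `f(a, nil) = g(a)` and `f(a, cons(x, l)) = h(x, f(a, l))`. -/
structure ListObject (X : C) where
  /-- the object of lists -/
  obj : C
  /-- the empty list -/
  nil : 𝟙_ C ⟶ obj
  /-- prepending an element to a list -/
  cons : X ⊗ obj ⟶ obj
  existsUnique_rec : ∀ {A B : C} (g : A ⟶ B) (h : X ⊗ B ⟶ B), ∃! f : A ⊗ obj ⟶ B,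
    lift (𝟙 A) (toUnit A ≫ nil) ≫ f = g ∧
    A ◁ cons ≫ f = lift (snd A (X ⊗ obj) ≫ fst X obj) (A ◁ snd X obj ≫ f) ≫ h

variable (C) in
/-- A (parametrized) natural numbers object. In terms of generalized elements, the two equations
that determine `f` are `f(a, 0) = g(a)` and `f(a, s n) = h(a, n, f(a, n))`. -/
structure NaturalNumbersObject where
  /-- the object of natural numbers -/
  obj : C
  /-- zero -/
  zero : 𝟙_ C ⟶ obj
  /-- the successor map -/
  succ : obj ⟶ obj
  existsUnique_rec : ∀ {A B : C} (g : A ⟶ B) (h : A ⊗ (obj ⊗ B) ⟶ B), ∃! f : A ⊗ obj ⟶ B,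
    lift (𝟙 A) (toUnit A ≫ zero) ≫ f = g ∧
    A ◁ succ ≫ f = lift (fst A obj) (lift (snd A obj) f) ≫ h

namespace ListObject

/-- The list object property without parameters. -/
theorem existsUnique_fold {X : C} (L : ListObject X) {B : C} (b : 𝟙_ C ⟶ B) (h : X ⊗ B ⟶ B) :
    ∃! f : L.obj ⟶ B, L.nil ≫ f = b ∧ L.cons ≫ f = X ◁ f ≫ h := by
  obtain ⟨f, ⟨h0, h1⟩, hu⟩ := L.existsUnique_rec b h
  have key (k : L.obj ⟶ B) (k0 : L.nil ≫ k = b) (k1 : L.cons ≫ k = X ◁ k ≫ h) :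
      snd (𝟙_ C) L.obj ≫ k = f := by
    apply hu
    constructor
    · rw [lift_snd_assoc, Category.assoc, k0, toUnit_unique (toUnit (𝟙_ C)) (𝟙 _),
        Category.id_comp]
    · rw [whiskerLeft_snd_assoc, k1, ← Category.assoc, ← Category.assoc]
      congr 1
      ext <;> simp [leftUnitor_hom]
  refine ⟨lift (toUnit _) (𝟙 _) ≫ f, ⟨?_, ?_⟩, ?_⟩
  · rw [← h0, ← Category.assoc]
    congr 1
    ext <;> simp
  · have : L.cons ≫ lift (toUnit _) (𝟙 _) = lift (toUnit _) (𝟙 _) ≫ 𝟙_ C ◁ L.cons := by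
      ext <;> simp
    rw [← Category.assoc, this, Category.assoc, h1, ← Category.assoc]
    congr 1
    ext
    · simp
    · simp only [Category.assoc, lift_snd, whiskerLeft_snd]
      rw [← Category.assoc, ← Category.assoc]
      congr 1
      ext <;> simp
  · rintro k ⟨k0, k1⟩
    rw [← key k k0 k1, lift_snd_assoc, Category.id_comp]

/-- The map `L(X) ⟶ B` with `nil ↦ b` and `cons(x, l) ↦ h(x, fold(l))`. -/
noncomputable def fold {X : C} (L : ListObject X) {B : C} (b : 𝟙_ C ⟶ B) (h : X ⊗ B ⟶ B) :
    L.obj ⟶ B :=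
  (L.existsUnique_fold b h).choose

theorem nil_fold {X : C} (L : ListObject X) {B : C} (b : 𝟙_ C ⟶ B) (h : X ⊗ B ⟶ B) :
    L.nil ≫ L.fold b h = b :=
  (L.existsUnique_fold b h).choose_spec.1.1

theorem cons_fold {X : C} (L : ListObject X) {B : C} (b : 𝟙_ C ⟶ B) (h : X ⊗ B ⟶ B) :
    L.cons ≫ L.fold b h = X ◁ L.fold b h ≫ h :=
  (L.existsUnique_fold b h).choose_spec.1.2

theorem eq_fold {X : C} (L : ListObject X) {B : C} (b : 𝟙_ C ⟶ B) (h : X ⊗ B ⟶ B)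
    (k : L.obj ⟶ B) (k0 : L.nil ≫ k = b) (k1 : L.cons ≫ k = X ◁ k ≫ h) :
    k = L.fold b h :=
  (L.existsUnique_fold b h).choose_spec.2 k ⟨k0, k1⟩

/-- The successor map `l ↦ cons(*, l)` on `L(1)`. -/
def succ (L : ListObject (𝟙_ C)) : L.obj ⟶ L.obj :=
  lift (toUnit L.obj) (𝟙 L.obj) ≫ L.cons

theorem existsUnique_iter (L : ListObject (𝟙_ C)) {A B : C} (g : A ⟶ B) (h : B ⟶ B) :
    ∃! f : A ⊗ L.obj ⟶ B, lift (𝟙 A) (toUnit A ≫ L.nil) ≫ f = g ∧ A ◁ L.succ ≫ f = f ≫ h := by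
  have e1 : A ◁ L.succ = A ◁ lift (toUnit L.obj) (𝟙 L.obj) ≫ A ◁ L.cons := by
    simp [succ]
  have e0 : snd (𝟙_ C) L.obj ≫ lift (toUnit L.obj) (𝟙 L.obj) = 𝟙 _ := by
    ext <;> simp
  have e2 : A ◁ L.cons = A ◁ snd (𝟙_ C) L.obj ≫ A ◁ L.succ := by
    rw [← MonoidalCategory.whiskerLeft_comp, succ, ← Category.assoc, e0, Category.id_comp]
  have e3 : A ◁ lift (toUnit L.obj) (𝟙 L.obj) ≫ A ◁ snd (𝟙_ C) L.obj = 𝟙 _ := by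
    ext <;> simp
  have iff (f : A ⊗ L.obj ⟶ B) : A ◁ L.succ ≫ f = f ≫ h ↔
      A ◁ L.cons ≫ f = lift (snd A (𝟙_ C ⊗ L.obj) ≫ fst (𝟙_ C) L.obj)
        (A ◁ snd (𝟙_ C) L.obj ≫ f) ≫ (snd (𝟙_ C) B ≫ h) := by
    rw [lift_snd_assoc]
    constructor
    · intro hf
      rw [e2, Category.assoc, hf, Category.assoc]
    · intro hf
      rw [e1, Category.assoc, hf, ← Category.assoc, ← Category.assoc, e3, Category.id_comp]
  simp only [iff]
  exact L.existsUnique_rec g (snd (𝟙_ C) B ≫ h)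

/-- `L(1)` is a natural numbers object, with the empty list as zero and `l ↦ cons(*, l)` as
successor. -/
def toNaturalNumbersObject (L : ListObject (𝟙_ C)) : NaturalNumbersObject C where
  obj := L.obj
  zero := L.nil
  succ := L.succ
  existsUnique_rec {A B} g h := by
    let z : A ⟶ L.obj := toUnit A ≫ L.nil
    let G : A ⟶ A ⊗ (L.obj ⊗ B) := lift (𝟙 A) (lift z g)
    let H : A ⊗ (L.obj ⊗ B) ⟶ A ⊗ (L.obj ⊗ B) :=
      lift (fst _ _) (lift (snd _ _ ≫ fst _ _ ≫ L.succ) h)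
    obtain ⟨F, ⟨F0, F1⟩, Fu⟩ := L.existsUnique_iter G H
    have hA : F ≫ fst _ _ = fst _ _ := by
      refine (L.existsUnique_iter (𝟙 A) (𝟙 A)).unique ⟨?_, ?_⟩ ⟨?_, ?_⟩
      · rw [← Category.assoc, F0]; simp [G]
      · rw [← Category.assoc, F1]; simp [H]
      · simp
      · simp
    have hN : F ≫ snd _ _ ≫ fst _ _ = snd _ _ := by
      refine (L.existsUnique_iter z L.succ).unique ⟨?_, ?_⟩ ⟨?_, ?_⟩
      · rw [← Category.assoc, F0]; simp [G]
      · rw [← Category.assoc, F1]; simp [H]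
      · simp [z]
      · simp
    have hF : F = lift (fst _ _) (lift (snd _ _) (F ≫ snd _ _ ≫ snd _ _)) := by
      ext
      · simpa using hA
      · simpa using hN
      · simp
    refine ⟨F ≫ snd _ _ ≫ snd _ _, ⟨?_, ?_⟩, ?_⟩
    · rw [← Category.assoc, F0]; simp [G]
    · rw [← Category.assoc, F1, ← hF]; simp [H]
    · rintro k ⟨k0, k1⟩
      have : lift (fst _ _) (lift (snd _ _) k) = F := by
        apply Fu
        constructor
        · ext
          · simp [G]
          · simp [G, z]
          · simpa [G] using k0
        · ext
          · simp [H]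
          · simp [H]
          · simpa [H] using k1
      rw [← this]
      simp

end ListObject

/-- The list object functor associated with a choice of list objects: it sends `f : X ⟶ Y` to the
map with `nil ↦ nil` and `cons(x, l) ↦ cons(f(x), L(f)(l))`. -/
noncomputable def listFunctor (L : ∀ X : C, ListObject X) : C ⥤ C where
  obj X := (L X).obj
  map {X Y} f := (L X).fold (L Y).nil (f ▷ (L Y).obj ≫ (L Y).cons)
  map_id X := by
    symm
    apply ListObject.eq_fold <;> simp
  map_comp {X Y Z} f g := by
    symm
    apply ListObject.eq_fold
    · rw [← Category.assoc, ListObject.nil_fold, ListObject.nil_fold]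
    · rw [← Category.assoc, ListObject.cons_fold, Category.assoc, Category.assoc,
        ListObject.cons_fold]
      simp [whisker_exchange_assoc]

namespace NaturalNumbersObject

variable (N : NaturalNumbersObject C)

/-- Definition by primitive recursion with parameters. -/
noncomputable def recursor {A B : C} (g : A ⟶ B) (h : A ⊗ (N.obj ⊗ B) ⟶ B) : A ⊗ N.obj ⟶ B :=
  (N.existsUnique_rec g h).choose

/-- The predecessor: `P(0) = 0` and `P(s n) = n`. -/
noncomputable def pred : N.obj ⟶ N.obj :=
  lift (toUnit N.obj) (𝟙 N.obj) ≫
    N.recursor N.zero (snd (𝟙_ C) (N.obj ⊗ N.obj) ≫ fst N.obj N.obj)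

/-- Truncated subtraction `(m, n) ↦ m ∸ n`: `m ∸ 0 = m` and `m ∸ s n = P(m ∸ n)`. -/
noncomputable def monus : N.obj ⊗ N.obj ⟶ N.obj :=
  N.recursor (𝟙 N.obj) (snd N.obj (N.obj ⊗ N.obj) ≫ snd N.obj N.obj ≫ N.pred)

variable [HasFiniteLimits C]

/-- The object `E = {(m, n) : m < n}`: the equalizer of `(m, n) ↦ s m ∸ n` and `(m, n) ↦ 0`. -/
noncomputable def E : C :=
  equalizer (N.succ ▷ N.obj ≫ N.monus) (toUnit (N.obj ⊗ N.obj) ≫ N.zero)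

/-- The second projection `E ⟶ N`, `(m, n) ↦ n`. -/
noncomputable def projE : N.E ⟶ N.obj :=
  equalizer.ι (N.succ ▷ N.obj ≫ N.monus) (toUnit (N.obj ⊗ N.obj) ≫ N.zero) ≫ snd N.obj N.obj

end NaturalNumbersObject

variable [HasFiniteLimits C]

/-- A morphism is exponentiable if pulling back along it has a right adjoint, the dependent
product functor. -/
def IsExponentiable {A B : C} (f : A ⟶ B) : Prop :=
  (Over.pullback f).IsLeftAdjoint

/-- The dependent product functor along an exponentiable morphism. -/
noncomputable def dependentProduct {A B : C} (f : A ⟶ B) (hf : IsExponentiable f) :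
    Over A ⥤ Over B :=
  haveI : (Over.pullback f).IsLeftAdjoint := hf
  (Over.pullback f).rightAdjoint

/-- A polynomial `I ⟵ A ⟶ B ⟶ J`. -/
structure PolynomialDiagram (I J : C) where
  /-- the source of the middle map -/
  A : C
  /-- the target of the middle map -/
  B : C
  /-- the left map -/
  s : A ⟶ I
  /-- the middle map -/
  f : A ⟶ B
  /-- the right map -/
  t : B ⟶ J

/-- The polynomial functor associated with a polynomial whose middle map is exponentiable: pull
back along `s`, take the dependent product along `f`, compose with `t`. -/
noncomputable def PolynomialDiagram.functor {I J : C} (P : PolynomialDiagram I J)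
    (hP : IsExponentiable P.f) : Over I ⥤ Over J :=
  Over.pullback P.s ⋙ dependentProduct P.f hP ⋙ Over.map P.t

/-- `P` represents `F : C/I ⥤ C/J` if the polynomial functor of `P` exists and is isomorphic
to `F`. -/
def PolynomialDiagram.Represents {I J : C} (P : PolynomialDiagram I J) (F : Over I ⥤ Over J) :
    Prop :=
  ∃ hP : IsExponentiable P.f, Nonempty (F ≅ P.functor hP)

variable (C) in
/-- The usual identification of the slice over the terminal object with the category. -/
noncomputable def overTerminal : Over (𝟙_ C) ≌ C :=
  Over.equivalenceOfIsTerminal isTerminalTensorUnit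

/-- An endofunctor of `C` seen as an endofunctor of the slice over the terminal object. -/
noncomputable def onOverTerminal (F : C ⥤ C) : Over (𝟙_ C) ⥤ Over (𝟙_ C) :=
  (overTerminal C).functor ⋙ F ⋙ (overTerminal C).inverse

/-- `P` represents the endofunctor `F` of `C`, identified with the slice over the terminal
object. -/
def PolynomialDiagram.RepresentsEndofunctor (P : PolynomialDiagram (𝟙_ C) (𝟙_ C)) (F : C ⥤ C) :
    Prop :=
  P.Represents (onOverTerminal F)

/-- An endofunctor of `C` is a polynomial functor if some polynomial represents it. -/
def IsPolynomialEndofunctor (F : C ⥤ C) : Prop :=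
  ∃ P : PolynomialDiagram (𝟙_ C) (𝟙_ C), P.RepresentsEndofunctor F

/-- The polynomial `1 ⟵ E ⟶ N ⟶ 1` with the second projection in the middle. -/
noncomputable def listPolynomial (N : NaturalNumbersObject C) :
    PolynomialDiagram (𝟙_ C) (𝟙_ C) where
  A := N.E
  B := N.obj
  s := toUnit N.E
  f := N.projE
  t := toUnit N.obj

end LocosPoly

/-!
Two facts carry the proof. The first is that `L(X)`, lying over `N` by the length of lists,
represents families indexed by the fibres of `E`: for `n : Z ⟶ N`, the maps `Z ×_N E ⟶ X` correspond
naturally to the maps `Z ⟶ L(X)` over `N` (`ListObject.entries_bijective`). In other words, the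
functor `C/N ⥤ C`, `Z ↦ Z ×_N E`, is left adjoint to `X ↦ (L(X) ⟶ N)` (`pullbackForgetAdj`).

The second is that this suffices. The functor in question is pullback along `E ⟶ N` followed by the
forgetful functor `C/E ⥤ C`. The latter is left adjoint to `Y ↦ E × Y` with regular monomorphisms as
units, so by the adjoint triangle theorem the pullback functor itself has a right adjoint, because
`C/N` has equalizers (`isExponentiable_of_comp_forget`). Right adjoints compose and are unique, so
`C ⥤ C/E ⥤ C/N`, pullback followed by dependent product, is the list functor over `N`; forgetting
`N` gives the list functor.

For the first fact, positions in a list are counted from its end, so that the entry of `l` at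
position `k < length(l)` is the head of the list of its last `k + 1` entries. That this list has a
head follows from extensivity: the length is compatible with the decompositions of `L(X)` as
`1 + X × L(X)` and of `N` as `1 + N`, so a list of positive length is of the form `cons(x, l)`
(`ListObject.exists_eq_consAt`). Conversely a family `f(z, k)`, `k < n(z)`, is tabulated by
recursion on `k`: the list `r(z, k + 1)` is `cons(f(z, k), r(z, k))` if `k < n(z)`, and `r(z, k)`
otherwise. The lists of the last `k` entries of a list satisfy the same recursion for the family of
its entries (`ListObject.isTabulation_last`), so by uniqueness in the recursion principle a list is
determined by its entries; and the entries of `r(z, n(z))` are the given values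
(`ListObject.IsTabulation.entry_eq`).

All of this is carried out with generalized elements `T ⟶ A`. Operations on them commute with change
of stage, and two proof principles replace the internal logic: induction
(`NaturalNumbersObject.hom_ext_induction`), which applies to equations between maps, and case
distinction (`hom_ext_cases`), which passes to the two parts into which an element of a coproduct
decomposes its stage. Order relations are expressed through truncated subtraction, with `m < n`
meaning `(m + 1) ∸ n = 0` as in the definition of `E`.
-/

namespace LocosPoly

/-! ### Case distinctions in extensive categories -/

section Coproduct

variable {C : Type u} [Category.{v} C]

theorem nonempty_isColimit_of_existsUnique {P Q R : C} {i : P ⟶ R} {j : Q ⟶ R}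
    (h : ∀ {B : C} (b : P ⟶ B) (c : Q ⟶ B), ∃! f : R ⟶ B, i ≫ f = b ∧ j ≫ f = c) :
    Nonempty (IsColimit (BinaryCofan.mk i j)) :=
  ⟨BinaryCofan.isColimitMk (fun s => (h s.inl s.inr).choose)
    (fun s => (h s.inl s.inr).choose_spec.1.1) (fun s => (h s.inl s.inr).choose_spec.1.2)
    (fun s m h₁ h₂ => (h s.inl s.inr).choose_spec.2 m ⟨h₁, h₂⟩)⟩

variable [HasFiniteLimits C] [FinitaryExtensive C] {P Q R : C} {i : P ⟶ R} {j : Q ⟶ R}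

/-- A coproduct decomposition of `R` induces one of every object over `R`. -/
theorem nonempty_isColimit_pullback (hc : IsColimit (BinaryCofan.mk i j)) {T : C} (n : T ⟶ R) :
    Nonempty (IsColimit (BinaryCofan.mk (pullback.fst n i) (pullback.fst n j))) :=
  ((BinaryCofan.isVanKampen_iff _).mp (FinitaryExtensive.vanKampen _ hc)
    (BinaryCofan.mk (pullback.fst n i) (pullback.fst n j)) (pullback.snd n i) (pullback.snd n j) n
    pullback.condition.symm pullback.condition.symm).mpr
    ⟨IsPullback.of_hasPullback n i, IsPullback.of_hasPullback n j⟩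

/-- Equality of maps out of `T` may be checked on the two parts into which a generalized element
`n` of a coproduct decomposes its stage `T`. -/
theorem hom_ext_cases (hc : IsColimit (BinaryCofan.mk i j)) {T B : C} (n : T ⟶ R) {f g : T ⟶ B}
    (h₁ : ∀ ⦃S : C⦄ (t : S ⟶ T) (p : S ⟶ P), t ≫ n = p ≫ i → t ≫ f = t ≫ g)
    (h₂ : ∀ ⦃S : C⦄ (t : S ⟶ T) (q : S ⟶ Q), t ≫ n = q ≫ j → t ≫ f = t ≫ g) : f = g := by
  obtain ⟨hT⟩ := nonempty_isColimit_pullback hc n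
  exact BinaryCofan.IsColimit.hom_ext hT (h₁ _ _ pullback.condition) (h₂ _ _ pullback.condition)

/-- Definition by cases: a generalized element `n` of a coproduct decomposes its stage `T` into two
parts, and maps on them glue. -/
theorem exists_hom_of_cases (hc : IsColimit (BinaryCofan.mk i j)) {T B : C} (n : T ⟶ R)
    (a : pullback n i ⟶ B) (b : pullback n j ⟶ B) :
    ∃ e : T ⟶ B, pullback.fst n i ≫ e = a ∧ pullback.fst n j ≫ e = b := by
  obtain ⟨hT⟩ := nonempty_isColimit_pullback hc n
  obtain ⟨e, he⟩ := BinaryCofan.IsColimit.desc' hT a b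
  exact ⟨e, he⟩

end Coproduct

variable {C : Type u} [Category.{v} C] [CartesianMonoidalCategory C]

/-! ### Natural numbers in generalized elements -/

namespace NaturalNumbersObject

variable (N : NaturalNumbersObject C)

/-- The generalized element `0` of `N` at stage `T`. -/
def zeroAt (T : C) : T ⟶ N.obj := toUnit T ≫ N.zero

@[simp]
theorem comp_zeroAt {S T : C} (t : S ⟶ T) : t ≫ N.zeroAt T = N.zeroAt S := by
  simp [zeroAt]

/-- The successor of a generalized element of `N`. -/
def succAt {T : C} (n : T ⟶ N.obj) : T ⟶ N.obj := n ≫ N.succ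

@[simp]
theorem comp_succAt {S T : C} (t : S ⟶ T) (n : T ⟶ N.obj) :
    t ≫ N.succAt n = N.succAt (t ≫ n) := by
  simp [succAt]

theorem lift_zeroAt_recursor {A B T : C} (g : A ⟶ B) (h : A ⊗ (N.obj ⊗ B) ⟶ B) (a : T ⟶ A) :
    lift a (N.zeroAt T) ≫ N.recursor g h = a ≫ g := by
  have h0 : lift (𝟙 A) (toUnit A ≫ N.zero) ≫ N.recursor g h = g :=
    (N.existsUnique_rec g h).choose_spec.1.1
  conv_rhs => rw [← h0]
  rw [← Category.assoc, comp_lift]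
  simp [zeroAt]

theorem lift_succAt_recursor {A B T : C} (g : A ⟶ B) (h : A ⊗ (N.obj ⊗ B) ⟶ B) (a : T ⟶ A)
    (n : T ⟶ N.obj) :
    lift a (N.succAt n) ≫ N.recursor g h =
      lift a (lift n (lift a n ≫ N.recursor g h)) ≫ h := by
  have h1 : A ◁ N.succ ≫ N.recursor g h =
      lift (fst A N.obj) (lift (snd A N.obj) (N.recursor g h)) ≫ h :=
    (N.existsUnique_rec g h).choose_spec.1.2
  have := lift a n ≫= h1
  rw [← Category.assoc, ← Category.assoc, comp_lift, comp_lift] at this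
  simpa [succAt] using this

section Induction

variable [HasFiniteLimits C]

/-- Induction: the subobject of `A ⊗ N` on which `f` and `g` agree contains zero and is closed
under the successor, so the recursion principle splits its inclusion. -/
theorem hom_ext_induction {A B : C} {f g : A ⊗ N.obj ⟶ B}
    (h0 : ∀ ⦃T : C⦄ (a : T ⟶ A), lift a (N.zeroAt T) ≫ f = lift a (N.zeroAt T) ≫ g)
    (hs : ∀ ⦃T : C⦄ (a : T ⟶ A) (n : T ⟶ N.obj), lift a n ≫ f = lift a n ≫ g →
      lift a (N.succAt n) ≫ f = lift a (N.succAt n) ≫ g) : f = g := by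
  let e := equalizer.ι f g
  -- The recursion takes place in the subobject; its values `r` form a section of the inclusion `e`.
  have he : e ≫ f = e ≫ g := equalizer.condition f g
  let p : A ⊗ (N.obj ⊗ equalizer f g) ⟶ A ⊗ N.obj := snd _ _ ≫ snd _ _ ≫ e
  have hp : p ≫ f = p ≫ g := by simp only [p, Category.assoc, he]
  have hp' : lift (p ≫ fst _ _) (p ≫ snd _ _) = p := by ext <;> simp
  let r : A ⊗ N.obj ⟶ equalizer f g := N.recursor
    (equalizer.lift (lift (𝟙 A) (N.zeroAt A)) (h0 (𝟙 A)))
    (equalizer.lift (lift (p ≫ fst _ _) (N.succAt (p ≫ snd _ _)))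
      (hs _ _ (by rw [hp', hp])))
  have hr := (N.existsUnique_rec (equalizer.lift (lift (𝟙 A) (N.zeroAt A)) (h0 (𝟙 A)))
    (equalizer.lift (lift (p ≫ fst _ _) (N.succAt (p ≫ snd _ _)))
      (hs _ _ (by rw [hp', hp])))).choose_spec.1
  have key : r ≫ e = 𝟙 _ := by
    refine (N.existsUnique_rec (lift (𝟙 A) (N.zeroAt A))
      (snd A (N.obj ⊗ (A ⊗ N.obj)) ≫ snd _ _ ≫ A ◁ N.succ)).unique ⟨?_, ?_⟩ ⟨?_, ?_⟩
    · rw [← Category.assoc]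
      exact (congrArg (· ≫ e) hr.1).trans (equalizer.lift_ι _ _)
    · rw [← Category.assoc]
      refine (congrArg (· ≫ e) hr.2).trans ?_
      dsimp only
      rw [Category.assoc, equalizer.lift_ι]
      ext <;> simp [p, r, recursor, succAt]
    · simp [zeroAt]
    · simp
  calc f = r ≫ e ≫ f := by rw [← Category.assoc, key, Category.id_comp]
    _ = r ≫ e ≫ g := by rw [he]
    _ = g := by rw [← Category.assoc, key, Category.id_comp]

end Induction

/-- The predecessor of a generalized element of `N`. -/
noncomputable def predAt {T : C} (n : T ⟶ N.obj) : T ⟶ N.obj := n ≫ N.pred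

@[simp]
theorem comp_predAt {S T : C} (t : S ⟶ T) (n : T ⟶ N.obj) :
    t ≫ N.predAt n = N.predAt (t ≫ n) := by
  simp [predAt]

@[simp]
theorem predAt_zeroAt (T : C) : N.predAt (N.zeroAt T) = N.zeroAt T := by
  have := N.lift_zeroAt_recursor N.zero (snd (𝟙_ C) (N.obj ⊗ N.obj) ≫ fst N.obj N.obj) (toUnit T)
  rw [predAt, pred, ← Category.assoc, comp_lift]
  simpa [zeroAt] using this

@[simp]
theorem predAt_succAt {T : C} (n : T ⟶ N.obj) : N.predAt (N.succAt n) = n := by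
  have := N.lift_succAt_recursor N.zero (snd (𝟙_ C) (N.obj ⊗ N.obj) ≫ fst N.obj N.obj) (toUnit T) n
  rw [predAt, pred, ← Category.assoc, comp_lift]
  simpa using this

/-- The generalized element `a` if `c = 0`, and `b` if `c` is a successor. -/
noncomputable def ifZero {T B : C} (c : T ⟶ N.obj) (a b : T ⟶ B) : T ⟶ B :=
  lift (lift a b) c ≫ N.recursor (fst B B) (fst (B ⊗ B) (N.obj ⊗ B) ≫ snd B B)

@[simp]
theorem comp_ifZero {S T B : C} (t : S ⟶ T) (c : T ⟶ N.obj) (a b : T ⟶ B) :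
    t ≫ N.ifZero c a b = N.ifZero (t ≫ c) (t ≫ a) (t ≫ b) := by
  simp [ifZero, ← Category.assoc, comp_lift]

@[simp]
theorem ifZero_zeroAt {T B : C} (a b : T ⟶ B) : N.ifZero (N.zeroAt T) a b = a := by
  simp [ifZero, lift_zeroAt_recursor]

@[simp]
theorem ifZero_succAt {T B : C} (c : T ⟶ N.obj) (a b : T ⟶ B) :
    N.ifZero (N.succAt c) a b = b := by
  simp [ifZero, lift_succAt_recursor]

/-- At a stage where zero is a successor, any two generalized elements agree. -/
theorem eq_of_zeroAt_eq_succAt {T B : C} {n : T ⟶ N.obj} (h : N.zeroAt T = N.succAt n)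
    (f g : T ⟶ B) : f = g := by
  rw [← N.ifZero_zeroAt f g, h, ifZero_succAt]

/-- Truncated subtraction of generalized elements. -/
noncomputable def sub {T : C} (m n : T ⟶ N.obj) : T ⟶ N.obj := lift m n ≫ N.monus

@[simp]
theorem comp_sub {S T : C} (t : S ⟶ T) (m n : T ⟶ N.obj) :
    t ≫ N.sub m n = N.sub (t ≫ m) (t ≫ n) := by
  simp [sub, ← Category.assoc, comp_lift]

@[simp]
theorem sub_zeroAt {T : C} (m : T ⟶ N.obj) : N.sub m (N.zeroAt T) = m := by
  simp [sub, monus, lift_zeroAt_recursor]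

@[simp]
theorem sub_succAt {T : C} (m n : T ⟶ N.obj) : N.sub m (N.succAt n) = N.predAt (N.sub m n) := by
  simp [sub, monus, lift_succAt_recursor, predAt]

end NaturalNumbersObject

/-! ### `N` and `L(X)` as coproducts -/

namespace NaturalNumbersObject

variable (N : NaturalNumbersObject C) [HasFiniteLimits C]

/-- `N` is the coproduct of `1` and `N`, with injections zero and successor. -/
theorem nonempty_isColimit : Nonempty (IsColimit (BinaryCofan.mk N.zero N.succ)) := by
  refine nonempty_isColimit_of_existsUnique fun {B} b c => ?_
  let r : 𝟙_ C ⊗ N.obj ⟶ B := N.recursor b (snd (𝟙_ C) (N.obj ⊗ B) ≫ fst N.obj B ≫ c)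
  have r0 {T : C} (a : T ⟶ 𝟙_ C) : lift a (N.zeroAt T) ≫ r = a ≫ b :=
    N.lift_zeroAt_recursor _ _ _
  have rs {T : C} (a : T ⟶ 𝟙_ C) (n : T ⟶ N.obj) : lift a (N.succAt n) ≫ r = n ≫ c := by
    simpa using N.lift_succAt_recursor b (snd (𝟙_ C) (N.obj ⊗ B) ≫ fst N.obj B ≫ c) a n
  refine ⟨lift (toUnit _) (𝟙 _) ≫ r, ⟨?_, ?_⟩, ?_⟩
  · have := r0 (𝟙 (𝟙_ C))
    rw [← Category.assoc, comp_lift]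
    simpa [zeroAt, toUnit_unique (toUnit (𝟙_ C)) (𝟙 _)] using this
  · have := rs (toUnit _) (𝟙 N.obj)
    rw [← Category.assoc, comp_lift]
    simpa [succAt] using this
  · rintro m ⟨h₁, h₂⟩
    have key : snd (𝟙_ C) N.obj ≫ m = r := by
      apply N.hom_ext_induction
      · intro T a
        rw [r0, lift_snd_assoc, zeroAt, Category.assoc, h₁, toUnit_unique a (toUnit T)]
      · intro T a n _
        rw [rs, lift_snd_assoc, succAt, Category.assoc, h₂]
    rw [← key, lift_snd_assoc, Category.id_comp]

variable [FinitaryExtensive C]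

/-- Case distinction on a generalized natural number. -/
theorem hom_ext_cases {T B : C} (n : T ⟶ N.obj) {f g : T ⟶ B}
    (h₁ : ∀ ⦃S : C⦄ (t : S ⟶ T), t ≫ n = N.zeroAt S → t ≫ f = t ≫ g)
    (h₂ : ∀ ⦃S : C⦄ (t : S ⟶ T) (m : S ⟶ N.obj), t ≫ n = N.succAt m → t ≫ f = t ≫ g) :
    f = g := by
  obtain ⟨hc⟩ := N.nonempty_isColimit
  refine LocosPoly.hom_ext_cases hc n (fun S t p h => h₁ t ?_) h₂
  rw [h, zeroAt, toUnit_unique p (toUnit S)]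

/-- Definition by cases: a map defined where `n` vanishes extends by a given total map. -/
theorem exists_ifZero {T B : C} (n : T ⟶ N.obj) (a : equalizer n (N.zeroAt T) ⟶ B) (b : T ⟶ B) :
    ∃ e : T ⟶ B, (∀ ⦃S : C⦄ (t : S ⟶ T) (h : t ≫ n = t ≫ N.zeroAt T),
        t ≫ e = equalizer.lift t h ≫ a) ∧
      ∀ ⦃S : C⦄ (t : S ⟶ T) (m : S ⟶ N.obj), t ≫ n = N.succAt m → t ≫ e = t ≫ b := by
  obtain ⟨hc⟩ := N.nonempty_isColimit
  have hz : pullback.fst n N.zero ≫ n = pullback.fst n N.zero ≫ N.zeroAt T := by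
    rw [pullback.condition, comp_zeroAt, zeroAt, toUnit_unique (pullback.snd n N.zero) (toUnit _)]
  obtain ⟨e, he₁, he₂⟩ := exists_hom_of_cases hc n (equalizer.lift (pullback.fst n N.zero) hz ≫ a)
    (pullback.fst n N.succ ≫ b)
  refine ⟨e, fun S t h => ?_, fun S t m h => ?_⟩
  · have h' : t ≫ n = toUnit S ≫ N.zero := by rw [h, comp_zeroAt, zeroAt]
    have := pullback.lift t (toUnit S) h' ≫= he₁
    rw [pullback.lift_fst_assoc, ← Category.assoc] at this
    rw [this]
    congr 1
    apply equalizer.hom_ext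
    rw [Category.assoc, equalizer.lift_ι, equalizer.lift_ι, pullback.lift_fst]
  · have h : t ≫ n = m ≫ N.succ := h
    have := pullback.lift t m h ≫= he₂
    rwa [pullback.lift_fst_assoc, pullback.lift_fst_assoc] at this

end NaturalNumbersObject

namespace ListObject

variable {X : C} (L : ListObject X)

/-- `L(X)` is the coproduct of `1` and `X ⊗ L(X)`, with injections the empty list and `cons`. -/
theorem nonempty_isColimit : Nonempty (IsColimit (BinaryCofan.mk L.nil L.cons)) := by
  refine nonempty_isColimit_of_existsUnique fun {B} b c => ?_
  -- The recursion runs in `L(X) ⊗ B`, so that the tail of a list stays available.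
  let r : L.obj ⟶ L.obj ⊗ B := L.fold (lift L.nil b) (lift (X ◁ fst _ _ ≫ L.cons) (X ◁ fst _ _ ≫ c))
  have r0 : L.nil ≫ r = lift L.nil b := L.nil_fold _ _
  have rs : L.cons ≫ r = X ◁ r ≫ lift (X ◁ fst _ _ ≫ L.cons) (X ◁ fst _ _ ≫ c) :=
    L.cons_fold _ _
  have hr : r ≫ fst _ _ = 𝟙 _ := by
    refine (L.existsUnique_fold L.nil L.cons).unique ⟨?_, ?_⟩ ⟨by simp, by simp⟩
    · rw [← Category.assoc, r0, lift_fst]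
    · rw [← Category.assoc, rs, Category.assoc, lift_fst,
        ← MonoidalCategory.whiskerLeft_comp_assoc]
  refine ⟨r ≫ snd _ _, ⟨?_, ?_⟩, ?_⟩
  · rw [← Category.assoc, r0, lift_snd]
  · rw [← Category.assoc, rs, Category.assoc, lift_snd,
      ← MonoidalCategory.whiskerLeft_comp_assoc, hr]
    simp
  · rintro m ⟨h₁, h₂⟩
    have : lift (𝟙 _) m = r := by
      apply L.eq_fold
      · ext <;> simp [h₁]
      · ext <;> simp [h₂, ← MonoidalCategory.whiskerLeft_comp_assoc]
    rw [← this, lift_snd]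

/-- The generalized list `cons(x, l)`. -/
def consAt {T : C} (x : T ⟶ X) (l : T ⟶ L.obj) : T ⟶ L.obj := lift x l ≫ L.cons

/-- The empty list as a generalized element at stage `T`. -/
def nilAt (T : C) : T ⟶ L.obj := toUnit T ≫ L.nil

@[simp]
theorem comp_nilAt {S T : C} (t : S ⟶ T) : t ≫ L.nilAt T = L.nilAt S := by
  simp [nilAt]

theorem comp_consAt {S T : C} (t : S ⟶ T) (x : T ⟶ X) (l : T ⟶ L.obj) :
    t ≫ L.consAt x l = L.consAt (t ≫ x) (t ≫ l) := by
  simp [consAt, ← Category.assoc, comp_lift]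

variable [HasFiniteLimits C] [FinitaryExtensive C]

/-- Case distinction on a generalized list. -/
theorem hom_ext_cases {T B : C} (l : T ⟶ L.obj) {f g : T ⟶ B}
    (h₁ : ∀ ⦃S : C⦄ (t : S ⟶ T), t ≫ l = L.nilAt S → t ≫ f = t ≫ g)
    (h₂ : ∀ ⦃S : C⦄ (t : S ⟶ T) (x : S ⟶ X) (l' : S ⟶ L.obj), t ≫ l = L.consAt x l' →
      t ≫ f = t ≫ g) : f = g := by
  obtain ⟨hc⟩ := L.nonempty_isColimit
  refine LocosPoly.hom_ext_cases hc l (fun S t p h => h₁ t ?_)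
    (fun S t q h => h₂ t (q ≫ fst _ _) (q ≫ snd _ _) ?_)
  · rw [h, nilAt, toUnit_unique p (toUnit S)]
  · rw [h, consAt, lift_comp_fst_snd]

end ListObject

/-! ### Truncated subtraction and the order -/

namespace NaturalNumbersObject

variable (N : NaturalNumbersObject C) [HasFiniteLimits C] {T : C}

@[simp]
theorem sub_succAt_succAt (m n : T ⟶ N.obj) :
    N.sub (N.succAt m) (N.succAt n) = N.sub m n := by
  have : N.sub (N.succAt (fst N.obj N.obj)) (N.succAt (snd _ _)) = N.sub (fst _ _) (snd _ _) := by
    apply N.hom_ext_induction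
    · simp
    · intro T a n h
      have := N.sub_succAt (N.succAt a) (N.succAt n)
      simp_all
  simpa using lift m n ≫= this

@[simp]
theorem zeroAt_sub (n : T ⟶ N.obj) : N.sub (N.zeroAt T) n = N.zeroAt T := by
  have : N.sub (N.zeroAt (𝟙_ C ⊗ N.obj)) (snd _ _) = N.zeroAt _ := by
    apply N.hom_ext_induction
    · simp
    · intro T a n h
      simp_all
  simpa using lift (toUnit T) n ≫= this

@[simp]
theorem sub_self (n : T ⟶ N.obj) : N.sub n n = N.zeroAt T := by
  have : N.sub (snd (𝟙_ C) N.obj) (snd _ _) = N.zeroAt _ := by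
    apply N.hom_ext_induction
    · simp
    · intro T a n h
      simpa [-sub_succAt] using h
  simpa using lift (toUnit T) n ≫= this

theorem predAt_sub (m n : T ⟶ N.obj) : N.sub (N.predAt m) n = N.predAt (N.sub m n) := by
  have : N.sub (N.predAt (fst N.obj N.obj)) (snd _ _) =
      N.predAt (N.sub (fst _ _) (snd _ _)) := by
    apply N.hom_ext_induction
    · simp
    · intro T a n h
      simp_all
  simpa using lift m n ≫= this

/-- `m ∸ k ≤ m`. -/
@[simp]
theorem sub_sub_self (m k : T ⟶ N.obj) : N.sub (N.sub m k) m = N.zeroAt T := by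
  have : N.sub (N.sub (fst N.obj N.obj) (snd _ _)) (fst _ _) = N.zeroAt _ := by
    apply N.hom_ext_induction
    · simp
    · intro T a n h
      simp_all [predAt_sub]
  simpa using lift m k ≫= this

/-- `j < n` implies `j ≤ n`. -/
theorem sub_of_succAt_sub {j n : T ⟶ N.obj} (h : N.sub (N.succAt j) n = N.zeroAt T) :
    N.sub j n = N.zeroAt T := by
  rw [← N.predAt_succAt j, predAt_sub, h, predAt_zeroAt]

variable [FinitaryExtensive C]

/-- Induction on two numbers at once. The pairs `(m ∸ (n ∸ k), n ∸ (n ∸ k))` lead, for growing `k`,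
from `(m ∸ n, 0)` along the diagonal direction to `(m, n)`. -/
theorem hom_ext_double_induction {B : C} {f g : N.obj ⊗ N.obj ⟶ B}
    (h₁ : ∀ ⦃T : C⦄ (m : T ⟶ N.obj), lift m (N.zeroAt T) ≫ f = lift m (N.zeroAt T) ≫ g)
    (h₂ : ∀ ⦃T : C⦄ (n : T ⟶ N.obj), lift (N.zeroAt T) n ≫ f = lift (N.zeroAt T) n ≫ g)
    (h₃ : ∀ ⦃T : C⦄ (m n : T ⟶ N.obj), lift m n ≫ f = lift m n ≫ g →
      lift (N.succAt m) (N.succAt n) ≫ f = lift (N.succAt m) (N.succAt n) ≫ g) : f = g := by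
  let D {T : C} (m n k : T ⟶ N.obj) : T ⟶ N.obj ⊗ N.obj :=
    lift (N.sub m (N.sub n k)) (N.sub n (N.sub n k))
  have hD {S T B : C} (t : S ⟶ T) (m n k : T ⟶ N.obj) (f : N.obj ⊗ N.obj ⟶ B) :
      t ≫ D m n k ≫ f = D (t ≫ m) (t ≫ n) (t ≫ k) ≫ f := by
    simp [D, comp_lift_assoc]
  -- If `n ∸ k = j + 1`, the pair at `k` consists of the predecessors of the pair at `k + 1`, so it
  -- suffices to pass from the predecessors of two numbers to the numbers themselves.
  have step {S : C} (a b : S ⟶ N.obj)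
      (h : lift (N.predAt a) (N.predAt b) ≫ f = lift (N.predAt a) (N.predAt b) ≫ g) :
      lift a b ≫ f = lift a b ≫ g := by
    refine N.hom_ext_cases a (fun S t ha => ?_) (fun S t a' ha => ?_)
    · simpa [comp_lift_assoc, ha] using h₂ (t ≫ b)
    · refine N.hom_ext_cases (t ≫ b) (fun S s hb => ?_) (fun S s b' hb => ?_)
      · simpa [comp_lift_assoc, hb] using h₁ (s ≫ t ≫ a)
      · have := h₃ (s ≫ a') b' (by simpa [comp_lift_assoc, ha, hb] using s ≫= t ≫= h)
        simpa [comp_lift_assoc, ha, hb] using this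
  have : D (fst (N.obj ⊗ N.obj) N.obj ≫ fst _ _) (fst (N.obj ⊗ N.obj) N.obj ≫ snd _ _)
        (snd _ _) ≫ f = D (fst _ _ ≫ fst _ _) (fst _ _ ≫ snd _ _) (snd _ _) ≫ g := by
    apply N.hom_ext_induction
    · intro T p
      simpa [hD, D] using h₁ (N.sub (p ≫ fst _ _) (p ≫ snd _ _))
    · intro T p k h
      simp only [hD, lift_fst_assoc, lift_snd] at h ⊢
      refine N.hom_ext_cases (N.sub (p ≫ snd _ _) k) (fun S t ht => ?_) (fun S t j ht => ?_)
      · have := t ≫= h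
        simp only [hD, comp_sub] at this ht ⊢
        simpa [D, ht] using this
      · have := t ≫= h
        simp only [hD, comp_sub, comp_succAt] at this ht ⊢
        simp only [D, sub_succAt, ht, predAt_succAt] at this ⊢
        exact step _ _ this
  have := lift (𝟙 _) (snd _ _) ≫= this
  simpa [hD, D] using this

/-- If `k < m` then `m ∸ k` is the successor of `m ∸ (k + 1)`, and otherwise it vanishes. -/
theorem ifZero_sub_succAt (k m : T ⟶ N.obj) :
    N.ifZero (N.sub (N.succAt k) m) (N.succAt (N.sub m (N.succAt k))) (N.zeroAt T) =
      N.sub m k := by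
  have : N.ifZero (N.sub (N.succAt (fst N.obj N.obj)) (snd _ _))
      (N.succAt (N.sub (snd _ _) (N.succAt (fst _ _)))) (N.zeroAt _) =
        N.sub (snd _ _) (fst _ _) := by
    apply N.hom_ext_double_induction
    · intro T k
      simp [-sub_succAt]
    · intro T m
      refine N.hom_ext_cases m (fun S t ht => ?_) (fun S t n ht => ?_)
      · simp [-sub_succAt, ht]
      · simp [-sub_succAt, ht]
    · intro T k m h
      simp_all [-sub_succAt]
  simpa [-sub_succAt] using lift k m ≫= this

/-- `k < m` implies `m ∸ k = (m ∸ (k + 1)) + 1`. -/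
theorem sub_of_lt {k m : T ⟶ N.obj} (h : N.sub (N.succAt k) m = N.zeroAt T) :
    N.sub m k = N.succAt (N.sub m (N.succAt k)) := by
  conv_lhs => rw [← ifZero_sub_succAt, h, ifZero_zeroAt]

/-- `m ≤ k` implies `m ∸ k = 0`. -/
theorem sub_of_not_lt {k m n : T ⟶ N.obj} (h : N.sub (N.succAt k) m = N.succAt n) :
    N.sub m k = N.zeroAt T := by
  rw [← ifZero_sub_succAt, h, ifZero_succAt]

/-- `j ≤ n` implies `n ∸ (n ∸ j) = j`. -/
theorem sub_sub_of_le {j n : T ⟶ N.obj} (h : N.sub j n = N.zeroAt T) :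
    N.sub n (N.sub n j) = j := by
  have : N.ifZero (N.sub (snd N.obj N.obj) (fst _ _))
      (N.sub (fst _ _) (N.sub (fst _ _) (snd _ _))) (snd _ _) = snd _ _ := by
    apply N.hom_ext_induction
    · simp
    · intro T n j ih
      simp only [comp_ifZero, comp_sub, lift_fst, lift_snd] at ih ⊢
      refine N.hom_ext_cases (N.sub (N.succAt j) n) (fun S t h₁ => ?_) (fun S t i h₁ => ?_)
      · simp only [comp_ifZero, comp_sub, comp_succAt] at h₁ ⊢
        rw [h₁, ifZero_zeroAt]
        have h₂ : N.sub (t ≫ j) (t ≫ n) = N.zeroAt S :=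
          N.sub_of_succAt_sub h₁
        have ih := t ≫= ih
        simp only [comp_ifZero, comp_sub, h₂, ifZero_zeroAt] at ih
        have h₃ := N.sub_of_lt h₁
        -- With `c = n ∸ (j + 1)` one has `n ∸ j = c + 1`, so `c < n`.
        rw [N.sub_of_lt (by rw [← h₃, sub_sub_self]), ← h₃, ih]
      · simp only [comp_ifZero, comp_sub, comp_succAt] at h₁ ⊢
        rw [h₁, ifZero_succAt]
  simpa [h] using lift n j ≫= this

end NaturalNumbersObject

/-! ### Length, tails and entries of lists -/

namespace ListObject

variable {X : C} (L : ListObject X)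

/-- The map sending a list to its tail, and the empty list to itself. -/
noncomputable def tail : L.obj ⟶ L.obj :=
  (BinaryCofan.IsColimit.desc' L.nonempty_isColimit.some L.nil (snd X L.obj)).1

/-- The tail of a generalized list. -/
noncomputable def tailAt {T : C} (l : T ⟶ L.obj) : T ⟶ L.obj := l ≫ L.tail

@[simp]
theorem comp_tailAt {S T : C} (t : S ⟶ T) (l : T ⟶ L.obj) :
    t ≫ L.tailAt l = L.tailAt (t ≫ l) := by
  simp [tailAt]

@[simp]
theorem tailAt_nilAt (T : C) : L.tailAt (L.nilAt T) = L.nilAt T := by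
  have h : L.nil ≫ L.tail = L.nil :=
    (BinaryCofan.IsColimit.desc' L.nonempty_isColimit.some L.nil (snd X L.obj)).2.1
  rw [tailAt, nilAt, Category.assoc, h]

@[simp]
theorem tailAt_consAt {T : C} (x : T ⟶ X) (l : T ⟶ L.obj) : L.tailAt (L.consAt x l) = l := by
  have h : L.cons ≫ L.tail = snd _ _ :=
    (BinaryCofan.IsColimit.desc' L.nonempty_isColimit.some L.nil (snd X L.obj)).2.2
  rw [tailAt, consAt, Category.assoc, h, lift_snd]

/-- The functorial action of list objects on morphisms. -/
noncomputable def map {X Y : C} (L : ListObject X) (L' : ListObject Y) (u : X ⟶ Y) :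
    L.obj ⟶ L'.obj :=
  L.fold L'.nil (u ▷ L'.obj ≫ L'.cons)

@[simp]
theorem nilAt_map {Y : C} (L' : ListObject Y) (u : X ⟶ Y) (T : C) :
    L.nilAt T ≫ L.map L' u = L'.nilAt T := by
  simp [nilAt, map, nil_fold]

@[simp]
theorem consAt_map {Y : C} (L' : ListObject Y) (u : X ⟶ Y) {T : C} (x : T ⟶ X) (l : T ⟶ L.obj) :
    L.consAt x l ≫ L.map L' u = L'.consAt (x ≫ u) (l ≫ L.map L' u) := by
  simp only [consAt, Category.assoc]
  rw [map, cons_fold, ← Category.assoc, ← Category.assoc, lift_whiskerLeft, lift_whiskerRight]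

variable (N : NaturalNumbersObject C)

/-- The length of a list. -/
noncomputable def length : L.obj ⟶ N.obj := L.fold N.zero (snd X N.obj ≫ N.succ)

/-- The length of a generalized list. -/
noncomputable def lengthAt {T : C} (l : T ⟶ L.obj) : T ⟶ N.obj := l ≫ L.length N

@[simp]
theorem comp_lengthAt {S T : C} (t : S ⟶ T) (l : T ⟶ L.obj) :
    t ≫ L.lengthAt N l = L.lengthAt N (t ≫ l) := by
  simp [lengthAt]

@[simp]
theorem lengthAt_nilAt (T : C) : L.lengthAt N (L.nilAt T) = N.zeroAt T := by
  simp [lengthAt, nilAt, length, nil_fold, NaturalNumbersObject.zeroAt]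

@[simp]
theorem lengthAt_consAt {T : C} (x : T ⟶ X) (l : T ⟶ L.obj) :
    L.lengthAt N (L.consAt x l) = N.succAt (L.lengthAt N l) := by
  simp [lengthAt, consAt, length, cons_fold, NaturalNumbersObject.succAt]

theorem map_length {Y : C} (L' : ListObject Y) (u : X ⟶ Y) :
    L.map L' u ≫ L'.length N = L.length N := by
  apply L.eq_fold
  · rw [map, ← Category.assoc, nil_fold, length, nil_fold]
  · rw [map, ← Category.assoc, cons_fold, length, Category.assoc, Category.assoc, cons_fold]
    simp

@[simp]
theorem lengthAt_map {Y : C} (L' : ListObject Y) (u : X ⟶ Y) {T : C} (l : T ⟶ L.obj) :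
    L'.lengthAt N (l ≫ L.map L' u) = L.lengthAt N l := by
  rw [lengthAt, Category.assoc, map_length, lengthAt]

theorem sub_lengthAt_comp {L : ListObject X} {N : NaturalNumbersObject C} {Z : C} {n : Z ⟶ N.obj}
    {g : Z ⟶ L.obj} (hg : g ≫ L.length N = n) {T : C} {z : T ⟶ Z} {k : T ⟶ N.obj}
    (h : N.sub k (z ≫ n) = N.zeroAt T) : N.sub k (L.lengthAt N (z ≫ g)) = N.zeroAt T := by
  rwa [lengthAt, Category.assoc, hg]

/-- The list obtained from `l` by dropping the first `n` entries. -/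
noncomputable def drop {T : C} (l : T ⟶ L.obj) (n : T ⟶ N.obj) : T ⟶ L.obj :=
  lift l n ≫ N.recursor (𝟙 L.obj) (snd L.obj (N.obj ⊗ L.obj) ≫ snd N.obj L.obj ≫ L.tail)

@[simp]
theorem comp_drop {S T : C} (t : S ⟶ T) (l : T ⟶ L.obj) (n : T ⟶ N.obj) :
    t ≫ L.drop N l n = L.drop N (t ≫ l) (t ≫ n) := by
  simp [drop, ← Category.assoc, comp_lift]

@[simp]
theorem drop_zeroAt {T : C} (l : T ⟶ L.obj) : L.drop N l (N.zeroAt T) = l := by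
  simp [drop, NaturalNumbersObject.lift_zeroAt_recursor]

@[simp]
theorem drop_succAt {T : C} (l : T ⟶ L.obj) (n : T ⟶ N.obj) :
    L.drop N l (N.succAt n) = L.tailAt (L.drop N l n) := by
  simp [drop, NaturalNumbersObject.lift_succAt_recursor, tailAt]

/-- The list of the last `k` entries of `l`, or `l` itself if it is shorter. -/
noncomputable def last {T : C} (l : T ⟶ L.obj) (k : T ⟶ N.obj) : T ⟶ L.obj :=
  L.drop N l (N.sub (L.lengthAt N l) k)

@[simp]
theorem comp_last {S T : C} (t : S ⟶ T) (l : T ⟶ L.obj) (k : T ⟶ N.obj) :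
    t ≫ L.last N l k = L.last N (t ≫ l) (t ≫ k) := by
  simp [last]

theorem consAt_left_injective [FinitaryExtensive C] {T : C} {x x' : T ⟶ X} {l l' : T ⟶ L.obj}
    (h : L.consAt x l = L.consAt x' l') : x = x' := by
  obtain ⟨hL⟩ := L.nonempty_isColimit
  have : Mono L.cons := FinitaryExtensive.mono_inr_of_isColimit hL
  have := (cancel_mono L.cons).mp h
  simpa using this =≫ fst _ _

variable [HasFiniteLimits C]

@[simp]
theorem last_lengthAt {T : C} (l : T ⟶ L.obj) : L.last N l (L.lengthAt N l) = l := by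
  simp [last]

variable [FinitaryExtensive C]

theorem tailAt_map {Y : C} (L' : ListObject Y) (u : X ⟶ Y) {T : C} (l : T ⟶ L.obj) :
    L.tailAt l ≫ L.map L' u = L'.tailAt (l ≫ L.map L' u) := by
  refine L.hom_ext_cases l (fun S t h => ?_) (fun S t x l' h => ?_)
  · rw [← Category.assoc, comp_tailAt, comp_tailAt, ← Category.assoc, h]
    simp
  · rw [← Category.assoc, comp_tailAt, comp_tailAt, ← Category.assoc, h]
    simp

theorem drop_map {Y : C} (L' : ListObject Y) (u : X ⟶ Y) {T : C} (l : T ⟶ L.obj)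
    (n : T ⟶ N.obj) :
    L.drop N l n ≫ L.map L' u = L'.drop N (l ≫ L.map L' u) n := by
  have : L.drop N (fst L.obj N.obj) (snd _ _) ≫ L.map L' u =
      L'.drop N (fst L.obj N.obj ≫ L.map L' u) (snd _ _) := by
    apply N.hom_ext_induction
    · intro T a
      rw [← Category.assoc]
      simp
    · intro T a n h
      rw [← Category.assoc] at h ⊢
      simp only [comp_drop, lift_fst, lift_snd, lift_fst_assoc, drop_succAt] at h ⊢
      rw [tailAt_map, h]
  have := lift l n ≫= this
  rw [← Category.assoc] at this
  simpa using this

theorem last_map {Y : C} (L' : ListObject Y) (u : X ⟶ Y) {T : C} (l : T ⟶ L.obj)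
    (k : T ⟶ N.obj) :
    L.last N l k ≫ L.map L' u = L'.last N (l ≫ L.map L' u) k := by
  simp [last, drop_map]

theorem lengthAt_tailAt {T : C} (l : T ⟶ L.obj) :
    L.lengthAt N (L.tailAt l) = N.predAt (L.lengthAt N l) := by
  refine L.hom_ext_cases l (fun S t h => ?_) (fun S t x l' h => ?_) <;> simp [h]

theorem lengthAt_drop {T : C} (l : T ⟶ L.obj) (n : T ⟶ N.obj) :
    L.lengthAt N (L.drop N l n) = N.sub (L.lengthAt N l) n := by
  have : L.lengthAt N (L.drop N (fst L.obj N.obj) (snd _ _)) =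
      N.sub (L.lengthAt N (fst _ _)) (snd _ _) := by
    apply N.hom_ext_induction
    · simp
    · intro T l n h
      simp_all [lengthAt_tailAt]
  simpa using lift l n ≫= this

theorem eq_nilAt_of_lengthAt {T : C} {l : T ⟶ L.obj} (h : L.lengthAt N l = N.zeroAt T) :
    l = L.nilAt T := by
  refine L.hom_ext_cases l (fun S t ht => by simp [ht]) (fun S t x l' ht => ?_)
  refine N.eq_of_zeroAt_eq_succAt (n := L.lengthAt N l') ?_ _ _
  rw [← lengthAt_consAt, ← ht, ← comp_lengthAt, h, NaturalNumbersObject.comp_zeroAt]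

/-- By extensivity, the lists of positive length are exactly those of the form `cons(x, l)`: the
length maps the decomposition `1 + X ⊗ L(X)` of `L(X)` to the decomposition `1 + N` of `N`. -/
theorem exists_eq_consAt {T : C} {l : T ⟶ L.obj} {n : T ⟶ N.obj}
    (h : L.lengthAt N l = N.succAt n) : ∃ x l', l = L.consAt x l' := by
  obtain ⟨hL⟩ := L.nonempty_isColimit
  obtain ⟨hN⟩ := N.nonempty_isColimit
  have h₀ : 𝟙 (𝟙_ C) ≫ N.zero = L.nil ≫ L.length N := by
    rw [length, nil_fold, Category.id_comp]
  have h₁ : (snd X L.obj ≫ L.length N) ≫ N.succ = L.cons ≫ L.length N := by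
    simp [length, cons_fold]
  have hp : IsPullback L.cons (snd _ _ ≫ L.length N) (L.length N) N.succ :=
    (((BinaryCofan.isVanKampen_iff _).mp (FinitaryExtensive.vanKampen _ hN)
      (BinaryCofan.mk L.nil L.cons) (𝟙 _) (snd _ _ ≫ L.length N) (L.length N) h₀ h₁).mp ⟨hL⟩).2
  have h : l ≫ L.length N = n ≫ N.succ := h
  refine ⟨hp.lift l n h ≫ fst _ _, hp.lift l n h ≫ snd _ _, ?_⟩
  rw [consAt, lift_comp_fst_snd, hp.lift_fst]

@[simp]
theorem last_zeroAt {T : C} (l : T ⟶ L.obj) : L.last N l (N.zeroAt T) = L.nilAt T := by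
  apply L.eq_nilAt_of_lengthAt N
  simp [last, lengthAt_drop]

theorem last_succAt_of_not_lt {T : C} {l : T ⟶ L.obj} {k n : T ⟶ N.obj}
    (h : N.sub (N.succAt k) (L.lengthAt N l) = N.succAt n) :
    L.last N l (N.succAt k) = L.last N l k := by
  rw [last, last, N.sub_succAt, N.sub_of_not_lt h, N.predAt_zeroAt]

theorem exists_last_succAt_of_lt {T : C} {l : T ⟶ L.obj} {k : T ⟶ N.obj}
    (h : N.sub (N.succAt k) (L.lengthAt N l) = N.zeroAt T) :
    ∃ x, L.last N l (N.succAt k) = L.consAt x (L.last N l k) := by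
  obtain ⟨x, l', hl⟩ := L.exists_eq_consAt N (l := L.last N l (N.succAt k)) (n := k)
    (by rw [last, lengthAt_drop, N.sub_sub_of_le h])
  refine ⟨x, ?_⟩
  have : L.last N l k = L.tailAt (L.last N l (N.succAt k)) := by
    rw [last, last, N.sub_of_lt h, drop_succAt]
  rw [this, hl, tailAt_consAt]

/-- The entry of `l` at position `k < length l`, where positions are counted from the end of the
list, so that `cons` does not shift the positions of the old entries. -/
noncomputable def entry {T : C} (l : T ⟶ L.obj) (k : T ⟶ N.obj)
    (h : N.sub (N.succAt k) (L.lengthAt N l) = N.zeroAt T) : T ⟶ X :=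
  (L.exists_last_succAt_of_lt N h).choose

theorem last_succAt_of_lt {T : C} {l : T ⟶ L.obj} {k : T ⟶ N.obj}
    (h : N.sub (N.succAt k) (L.lengthAt N l) = N.zeroAt T) :
    L.last N l (N.succAt k) = L.consAt (L.entry N l k h) (L.last N l k) :=
  (L.exists_last_succAt_of_lt N h).choose_spec

theorem eq_entry {T : C} {l l' : T ⟶ L.obj} {k : T ⟶ N.obj} {x : T ⟶ X}
    (h : N.sub (N.succAt k) (L.lengthAt N l) = N.zeroAt T)
    (hx : L.last N l (N.succAt k) = L.consAt x l') : x = L.entry N l k h :=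
  L.consAt_left_injective (hx.symm.trans (L.last_succAt_of_lt N h))

theorem comp_entry {S T : C} (t : S ⟶ T) {l : T ⟶ L.obj} {k : T ⟶ N.obj}
    (h : N.sub (N.succAt k) (L.lengthAt N l) = N.zeroAt T) :
    t ≫ L.entry N l k h = L.entry N (t ≫ l) (t ≫ k) (by simpa using t ≫= h) := by
  refine L.eq_entry N (l' := t ≫ L.last N l k) _ ?_
  simpa [comp_consAt] using t ≫= L.last_succAt_of_lt N h

theorem entry_map {Y : C} (L' : ListObject Y) (u : X ⟶ Y) {T : C} {l : T ⟶ L.obj}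
    {k : T ⟶ N.obj} (h : N.sub (N.succAt k) (L.lengthAt N l) = N.zeroAt T) :
    L.entry N l k h ≫ u = L'.entry N (l ≫ L.map L' u) k (by simpa using h) := by
  refine L'.eq_entry N (l' := L.last N l k ≫ L.map L' u) _ ?_
  rw [← last_map, L.last_succAt_of_lt N h, consAt_map]

end ListObject

variable [HasFiniteLimits C]

/-! ### Tabulation of families -/

namespace NaturalNumbersObject

variable (N : NaturalNumbersObject C)

/-- The inclusion of `E` into `N ⊗ N`. -/
noncomputable def inclE : N.E ⟶ N.obj ⊗ N.obj :=
  equalizer.ι (N.succ ▷ N.obj ≫ N.monus) (toUnit (N.obj ⊗ N.obj) ≫ N.zero)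

instance : Mono N.inclE :=
  inferInstanceAs (Mono (equalizer.ι (N.succ ▷ N.obj ≫ N.monus) (toUnit _ ≫ N.zero)))

theorem inclE_snd : N.inclE ≫ snd _ _ = N.projE := rfl

theorem inclE_lt : N.sub (N.succAt (N.inclE ≫ fst _ _)) N.projE = N.zeroAt N.E := by
  have h : N.inclE ≫ N.succ ▷ N.obj ≫ N.monus = N.inclE ≫ toUnit _ ≫ N.zero :=
    equalizer.condition _ _
  have e : lift ((N.inclE ≫ fst _ _) ≫ N.succ) N.projE = N.inclE ≫ N.succ ▷ N.obj := by
    ext <;> simp [inclE_snd]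
  rw [sub, succAt, e, Category.assoc, h, zeroAt, ← Category.assoc, comp_toUnit]

/-- The generalized element of `E` given by numbers `m < n`. -/
noncomputable def pairE {T : C} (m n : T ⟶ N.obj) (h : N.sub (N.succAt m) n = N.zeroAt T) :
    T ⟶ N.E :=
  equalizer.lift (lift m n)
    (by simpa [sub, succAt, zeroAt, ← Category.assoc, lift_whiskerRight] using h)

@[simp]
theorem pairE_inclE {T : C} (m n : T ⟶ N.obj) (h : N.sub (N.succAt m) n = N.zeroAt T) :
    N.pairE m n h ≫ N.inclE = lift m n :=
  equalizer.lift_ι _ _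

@[simp]
theorem pairE_projE {T : C} (m n : T ⟶ N.obj) (h : N.sub (N.succAt m) n = N.zeroAt T) :
    N.pairE m n h ≫ N.projE = n := by
  rw [← inclE_snd, ← Category.assoc, pairE_inclE, lift_snd]

variable {Z : C} (n : Z ⟶ N.obj)

/-- The generalized element of `Z ×_N E` given by `z` in `Z` and a number `k < n(z)`. -/
noncomputable def point {T : C} (z : T ⟶ Z) (k : T ⟶ N.obj)
    (h : N.sub (N.succAt k) (z ≫ n) = N.zeroAt T) : T ⟶ pullback n N.projE :=
  pullback.lift z (N.pairE k (z ≫ n) h) (by simp)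

/-- The number `k < n(z)` underlying an element of `Z ×_N E`. -/
noncomputable def position : pullback n N.projE ⟶ N.obj :=
  pullback.snd n N.projE ≫ N.inclE ≫ fst _ _

theorem position_lt :
    N.sub (N.succAt (N.position n)) (pullback.fst n N.projE ≫ n) = N.zeroAt _ := by
  simpa [position, pullback.condition] using pullback.snd n N.projE ≫= N.inclE_lt

@[simp]
theorem point_fst {T : C} (z : T ⟶ Z) (k : T ⟶ N.obj)
    (h : N.sub (N.succAt k) (z ≫ n) = N.zeroAt T) :
    N.point n z k h ≫ pullback.fst n N.projE = z :=
  pullback.lift_fst _ _ _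

@[simp]
theorem point_position {T : C} (z : T ⟶ Z) (k : T ⟶ N.obj)
    (h : N.sub (N.succAt k) (z ≫ n) = N.zeroAt T) :
    N.point n z k h ≫ N.position n = k := by
  rw [position, point, pullback.lift_snd_assoc, ← Category.assoc, pairE_inclE, lift_fst]

theorem hom_ext_pullback {T : C} {p q : T ⟶ pullback n N.projE}
    (h₁ : p ≫ pullback.fst n N.projE = q ≫ pullback.fst n N.projE)
    (h₂ : p ≫ N.position n = q ≫ N.position n) : p = q := by
  apply pullback.hom_ext h₁
  rw [← cancel_mono N.inclE]
  ext
  · simpa [position] using h₂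
  · simp only [Category.assoc, inclE_snd, ← pullback.condition]
    rw [reassoc_of% h₁]

@[simp]
theorem comp_point {S T : C} (t : S ⟶ T) (z : T ⟶ Z) (k : T ⟶ N.obj)
    (h : N.sub (N.succAt k) (z ≫ n) = N.zeroAt T) :
    t ≫ N.point n z k h = N.point n (t ≫ z) (t ≫ k) (by simpa using t ≫= h) := by
  apply N.hom_ext_pullback <;> simp

/-- Maps out of `Z ×_N E` are determined by their values at `(z, k)` with `k < n(z)`. -/
theorem hom_ext_point {X : C} {f g : pullback n N.projE ⟶ X}
    (h : ∀ ⦃T : C⦄ (z : T ⟶ Z) (k : T ⟶ N.obj) (hk : N.sub (N.succAt k) (z ≫ n) = N.zeroAt T),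
      N.point n z k hk ≫ f = N.point n z k hk ≫ g) : f = g := by
  have : N.point n (pullback.fst n N.projE) (N.position n) (N.position_lt n) = 𝟙 _ := by
    apply N.hom_ext_pullback <;> simp
  simpa [this] using h _ _ (N.position_lt n)

end NaturalNumbersObject

namespace ListObject

variable {X : C} (L : ListObject X) (N : NaturalNumbersObject C) {Z : C} (n : Z ⟶ N.obj)

/-- The map `r(z, k)` tabulates the family `f(z, i)`, `i < n(z)`: it is the list of the values
`f(z, i)` with `i < k` and `i < n(z)`, in decreasing order of `i`. -/
structure IsTabulation (f : pullback n N.projE ⟶ X) (r : Z ⊗ N.obj ⟶ L.obj) : Prop where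
  zero : ∀ ⦃T : C⦄ (z : T ⟶ Z), lift z (N.zeroAt T) ≫ r = L.nilAt T
  succ_of_lt : ∀ ⦃T : C⦄ (z : T ⟶ Z) (k : T ⟶ N.obj)
    (h : N.sub (N.succAt k) (z ≫ n) = N.zeroAt T),
    lift z (N.succAt k) ≫ r = L.consAt (N.point n z k h ≫ f) (lift z k ≫ r)
  succ_of_not_lt : ∀ ⦃T : C⦄ (z : T ⟶ Z) (k m : T ⟶ N.obj)
    (_ : N.sub (N.succAt k) (z ≫ n) = N.succAt m), lift z (N.succAt k) ≫ r = lift z k ≫ r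

variable {N n} [FinitaryExtensive C]

/-- The recursion that defines a tabulation: its step `(z, k, l) ↦ cons(f(z, k), l)` is defined on
the part of its domain where `k < n(z)`, and extended by `(z, k, l) ↦ l`. -/
theorem exists_isTabulation (f : pullback n N.projE ⟶ X) : ∃ r, L.IsTabulation N n f r := by
  let z : Z ⊗ (N.obj ⊗ L.obj) ⟶ Z := fst _ _
  let k : Z ⊗ (N.obj ⊗ L.obj) ⟶ N.obj := snd _ _ ≫ fst _ _
  let l : Z ⊗ (N.obj ⊗ L.obj) ⟶ L.obj := snd _ _ ≫ snd _ _
  let c := N.sub (N.succAt k) (z ≫ n)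
  let i := equalizer.ι c (N.zeroAt _)
  have hi : i ≫ c = i ≫ N.zeroAt _ := equalizer.condition _ _
  obtain ⟨h, h₁, h₂⟩ := N.exists_ifZero c
    (L.consAt (N.point n (i ≫ z) (i ≫ k) (by simpa [c] using hi) ≫ f) (i ≫ l)) l
  refine ⟨N.recursor (L.nilAt Z) h, ⟨fun T z' => ?_, fun T z' k' hk => ?_, fun T z' k' m hk => ?_⟩⟩
  · rw [N.lift_zeroAt_recursor, comp_nilAt]
  · rw [N.lift_succAt_recursor]
    have ht : lift z' (lift k' (lift z' k' ≫ N.recursor (L.nilAt Z) h)) ≫ c =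
        lift z' (lift k' (lift z' k' ≫ N.recursor (L.nilAt Z) h)) ≫ N.zeroAt _ := by
      simpa [c, z, k] using hk
    have hl : equalizer.lift _ ht ≫ i = _ := equalizer.lift_ι _ ht
    rw [h₁ _ ht, comp_consAt, ← Category.assoc, NaturalNumbersObject.comp_point]
    simp only [reassoc_of% hl]
    simp [z, k, l]
  · rw [N.lift_succAt_recursor, h₂ _ m (by simpa [c, z, k] using hk)]
    simp [l]

namespace IsTabulation

variable {L} {f : pullback n N.projE ⟶ X} {r r' : Z ⊗ N.obj ⟶ L.obj}

theorem unique (hr : L.IsTabulation N n f r) (hr' : L.IsTabulation N n f r') : r = r' := by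
  apply N.hom_ext_induction
  · intro T z
    rw [hr.zero, hr'.zero]
  · intro T z k ih
    refine N.hom_ext_cases (N.sub (N.succAt k) (z ≫ n)) (fun S t ht => ?_) (fun S t m ht => ?_)
    all_goals
      have ih := t ≫= ih
      simp only [NaturalNumbersObject.comp_sub, NaturalNumbersObject.comp_succAt,
        ← Category.assoc, comp_lift] at ih ht ⊢
    · rw [hr.succ_of_lt _ _ ht, hr'.succ_of_lt _ _ ht, ih]
    · rw [hr.succ_of_not_lt _ _ m ht, hr'.succ_of_not_lt _ _ m ht, ih]

/-- A tabulation at `k` has length `min(k, n(z))`. -/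
theorem lengthAt_eq (hr : L.IsTabulation N n f r) {T : C} (z : T ⟶ Z) (k : T ⟶ N.obj) :
    L.lengthAt N (lift z k ≫ r) = N.sub (z ≫ n) (N.sub (z ≫ n) k) := by
  have : L.lengthAt N r = N.sub (fst _ _ ≫ n) (N.sub (fst Z N.obj ≫ n) (snd _ _)) := by
    apply N.hom_ext_induction
    · intro T z
      simp [hr.zero]
    · intro T z k ih
      refine N.hom_ext_cases (N.sub (N.succAt k) (z ≫ n)) (fun S t ht => ?_) (fun S t m ht => ?_)
      all_goals
        have ih := t ≫= ih
        rw [← Category.assoc] at ih ⊢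
        rw [← Category.assoc t, comp_lift] at ih ⊢
        simp only [NaturalNumbersObject.comp_sub, NaturalNumbersObject.comp_succAt, comp_lengthAt,
          lift_fst_assoc, lift_snd, Category.assoc] at ih ht ⊢
      · rw [hr.succ_of_lt _ _ (by simpa using ht), lengthAt_consAt, ih, N.sub_sub_of_le ht,
          N.sub_sub_of_le (N.sub_of_succAt_sub ht)]
      · rw [hr.succ_of_not_lt _ _ m (by simpa using ht), ih, N.sub_succAt, N.sub_of_not_lt ht,
          N.predAt_zeroAt]
  simpa using lift z k ≫= this

/-- Dropping entries from the complete tabulation yields the partial tabulations. -/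
theorem drop_eq (hr : L.IsTabulation N n f r) {T : C} (z : T ⟶ Z) (i : T ⟶ N.obj) :
    L.drop N (lift z (z ≫ n) ≫ r) i = lift z (N.sub (z ≫ n) i) ≫ r := by
  have : L.drop N (lift (fst Z N.obj) (fst _ _ ≫ n) ≫ r) (snd _ _) =
      lift (fst _ _) (N.sub (fst _ _ ≫ n) (snd _ _)) ≫ r := by
    have hc {S T : C} (t : S ⟶ T) (a : T ⟶ Z) (b : T ⟶ N.obj) :
        t ≫ lift a b ≫ r = lift (t ≫ a) (t ≫ b) ≫ r := by
      rw [← Category.assoc, comp_lift]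
    apply N.hom_ext_induction
    · intro T z
      simp [hc]
    · intro T z i ih
      simp only [hc, comp_drop, NaturalNumbersObject.comp_sub, lift_fst_assoc, lift_fst,
        lift_snd, N.sub_succAt, drop_succAt] at ih ⊢
      rw [ih]
      refine N.hom_ext_cases (N.sub (z ≫ n) i) (fun S t ht => ?_) (fun S t j ht => ?_)
      · simp [hc, ht, hr.zero]
      · simp only [hc, comp_tailAt, NaturalNumbersObject.comp_predAt]
        have hj : N.sub (N.succAt j) ((t ≫ z) ≫ n) = N.zeroAt S := by
          rw [← ht, N.comp_sub, Category.assoc, N.sub_sub_self]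
        rw [ht, hr.succ_of_lt _ _ hj, tailAt_consAt, N.predAt_succAt]
  have := lift z i ≫= this
  simpa [comp_lift_assoc] using this

theorem lengthAt_lift (hr : L.IsTabulation N n f r) {T : C} (z : T ⟶ Z) :
    L.lengthAt N (lift z (z ≫ n) ≫ r) = z ≫ n := by
  rw [hr.lengthAt_eq, N.sub_self, N.sub_zeroAt]

theorem last_eq (hr : L.IsTabulation N n f r) {T : C} (z : T ⟶ Z) (k : T ⟶ N.obj)
    (h : N.sub k (z ≫ n) = N.zeroAt T) :
    L.last N (lift z (z ≫ n) ≫ r) k = lift z k ≫ r := by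
  rw [last, hr.lengthAt_lift, hr.drop_eq, N.sub_sub_of_le h]

/-- The entries of the complete tabulation of `f` are the values of `f`. -/
theorem entry_eq (hr : L.IsTabulation N n f r) {T : C} (z : T ⟶ Z) (k : T ⟶ N.obj)
    (h : N.sub (N.succAt k) (z ≫ n) = N.zeroAt T) :
    N.point n z k h ≫ f = L.entry N (lift z (z ≫ n) ≫ r) k (by rwa [hr.lengthAt_lift]) := by
  apply L.eq_entry N (l' := lift z k ≫ r)
  rw [hr.last_eq z _ h, hr.succ_of_lt z k h]

end IsTabulation

variable (n) in
/-- The family `(z, k) ↦ g(z)_k` of the entries of a `Z`-indexed list `g` with length `n`. -/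
noncomputable def entries (g : Z ⟶ L.obj) (hg : g ≫ L.length N = n) : pullback n N.projE ⟶ X :=
  L.entry N (pullback.fst n N.projE ≫ g) (N.position n)
    (by rw [lengthAt, Category.assoc, hg, N.position_lt])

theorem point_entries (g : Z ⟶ L.obj) (hg : g ≫ L.length N = n) {T : C} (z : T ⟶ Z)
    (k : T ⟶ N.obj) (h : N.sub (N.succAt k) (z ≫ n) = N.zeroAt T) :
    N.point n z k h ≫ L.entries n g hg =
      L.entry N (z ≫ g) k (sub_lengthAt_comp hg h) := by
  simp only [entries, comp_entry, NaturalNumbersObject.point_position]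
  congr 1
  rw [← Category.assoc, NaturalNumbersObject.point_fst]

/-- The lists of the last `k` entries of `g(z)` tabulate the entries of `g(z)`. -/
theorem isTabulation_last (g : Z ⟶ L.obj) (hg : g ≫ L.length N = n) :
    L.IsTabulation N n (L.entries n g hg) (L.last N (fst _ _ ≫ g) (snd _ _)) where
  zero T z := by simp
  succ_of_lt T z k h := by
    rw [point_entries]
    simpa using L.last_succAt_of_lt N (l := z ≫ g) (k := k)
      (by rwa [lengthAt, Category.assoc, hg])
  succ_of_not_lt T z k m h := by
    simpa using L.last_succAt_of_not_lt N (l := z ≫ g) (k := k) (n := m)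
      (by rwa [lengthAt, Category.assoc, hg])

/-- The list object `L(X)`, lying over `N` by the length, represents families of elements of `X`
indexed by the fibres of `E` over `N`. -/
theorem entries_bijective : Function.Bijective
    fun g : { g : Z ⟶ L.obj // g ≫ L.length N = n } => L.entries n g.1 g.2 := by
  constructor
  · rintro ⟨g, hg⟩ ⟨g', hg'⟩ h
    have h : L.entries n g hg = L.entries n g' hg' := h
    have ht := L.isTabulation_last g hg
    rw [h] at ht
    have := lift (𝟙 Z) n ≫= ht.unique (L.isTabulation_last g' hg')
    have hl (g : Z ⟶ L.obj) (hg : g ≫ L.length N = n) :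
        lift (𝟙 Z) n ≫ L.last N (fst _ _ ≫ g) (snd _ _) = g := by
      rw [comp_last, lift_snd, lift_fst_assoc, Category.id_comp]
      exact (congrArg _ hg.symm).trans (L.last_lengthAt N g)
    rw [hl g hg, hl g' hg'] at this
    exact Subtype.ext this
  · intro f
    obtain ⟨r, hr⟩ := L.exists_isTabulation f
    have hg : (lift (𝟙 Z) n ≫ r) ≫ L.length N = n := by
      simpa [lengthAt] using hr.lengthAt_lift (𝟙 Z)
    refine ⟨⟨_, hg⟩, N.hom_ext_point n fun T z k hk => ?_⟩
    rw [hr.entry_eq, point_entries]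
    congr 1
    rw [← Category.assoc, comp_lift, Category.comp_id]

end ListObject

/-! ### The adjunctions -/

theorem point_map_pullback (N : NaturalNumbersObject C) {Z Z' : Over N.obj} (f : Z ⟶ Z') {T : C}
    (z : T ⟶ Z.left) (k : T ⟶ N.obj) (h : N.sub (N.succAt k) (z ≫ Z.hom) = N.zeroAt T) :
    N.point Z.hom z k h ≫ ((Over.pullback N.projE).map f).left =
      N.point Z'.hom (z ≫ f.left) k (by simpa using h) := by
  apply N.hom_ext_pullback
  · have e : ((Over.pullback N.projE).map f).left ≫ pullback.fst Z'.hom N.projE =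
        pullback.fst Z.hom N.projE ≫ f.left := pullback.lift_fst _ _ _
    rw [N.point_fst, Category.assoc, e, ← Category.assoc, N.point_fst]
  · have e : ((Over.pullback N.projE).map f).left ≫ N.position Z'.hom = N.position Z.hom :=
      pullback.lift_snd_assoc _ _ _ _
    rw [N.point_position, Category.assoc, e, N.point_position]

section Adjunction

variable [FinitaryExtensive C] (L : ∀ X : C, ListObject X) (N : NaturalNumbersObject C)

/-- The list object functor with values in the slice over `N`, by means of the length. -/
noncomputable def lengthFunctor : C ⥤ Over N.obj where
  obj X := Over.mk ((L X).length N)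
  map {X Y} u := Over.homMk ((L X).map (L Y) u) ((L X).map_length N (L Y) u)
  map_id X := by
    ext
    exact (listFunctor L).map_id X
  map_comp u w := by
    ext
    exact (listFunctor L).map_comp u w

/-- Maps `Z ×_N E ⟶ X` correspond to maps `Z ⟶ L(X)` over `N`. -/
noncomputable def entriesEquiv (Z : Over N.obj) (X : C) :
    (Z ⟶ (lengthFunctor L N).obj X) ≃ ((Over.pullback N.projE ⋙ Over.forget N.E).obj Z ⟶ X) :=
  Equiv.ofBijective (fun g => (L X).entries Z.hom g.left (Over.w g)) <| by
    constructor
    · intro g g' h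
      ext
      exact congrArg Subtype.val ((L X).entries_bijective.1 (a₁ := ⟨g.left, Over.w g⟩)
        (a₂ := ⟨g'.left, Over.w g'⟩) h)
    · intro f
      obtain ⟨g, hg⟩ := (L X).entries_bijective.2 f
      exact ⟨Over.homMk g.1 g.2, hg⟩

theorem point_entriesEquiv {Z : Over N.obj} {X : C} (g : Z ⟶ (lengthFunctor L N).obj X) {T : C}
    (z : T ⟶ Z.left) (k : T ⟶ N.obj) (h : N.sub (N.succAt k) (z ≫ Z.hom) = N.zeroAt T) :
    N.point Z.hom z k h ≫ entriesEquiv L N Z X g =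
      (L X).entry N (z ≫ g.left) k (ListObject.sub_lengthAt_comp (Over.w g) h) :=
  (L X).point_entries g.left (Over.w g) z k h

/-- The functor `Z ↦ Z ×_N E` is left adjoint to the list object functor with values in `C/N`. -/
noncomputable def pullbackForgetAdj :
    Over.pullback N.projE ⋙ Over.forget N.E ⊣ lengthFunctor L N :=
  Adjunction.mkOfHomEquiv
    { homEquiv := fun Z X => (entriesEquiv L N Z X).symm
      homEquiv_naturality_left_symm := fun {Z' Z X} f g => by
        refine N.hom_ext_point _ fun T z k h => ?_
        refine (point_entriesEquiv L N (f ≫ g) z k h).trans ?_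
        refine Eq.trans ?_ (Category.assoc _ _ _)
        refine Eq.trans ?_ (congrArg (· ≫ _) (point_map_pullback N f z k h)).symm
        refine Eq.trans ?_ (point_entriesEquiv L N g (z ≫ f.left) k _).symm
        congr 1
        exact (Category.assoc _ _ _).symm
      homEquiv_naturality_right := fun {Z X Y} f u => by
        obtain ⟨g, rfl⟩ := (entriesEquiv L N Z X).surjective f
        refine (Equiv.symm_apply_eq _).mpr ?_
        refine Eq.trans ?_ (congrArg (fun g' => entriesEquiv L N Z Y
          (g' ≫ (lengthFunctor L N).map u)) ((entriesEquiv L N Z X).symm_apply_apply g).symm)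
        refine N.hom_ext_point _ fun T z k h => ?_
        refine Eq.trans ?_ (point_entriesEquiv L N (g ≫ (lengthFunctor L N).map u) z k h).symm
        refine (Category.assoc _ _ _).symm.trans ?_
        refine (congrArg (· ≫ u) (point_entriesEquiv L N g z k h)).trans ?_
        refine (ListObject.entry_map _ N (L Y) u _).trans ?_
        congr 1
        exact Category.assoc _ _ _ }

end Adjunction

/-- A map `η : Y ⟶ S` over `A`, where `S` is a product of `A` and `Y` through the projection to `A`
and a retraction `q` of `η`, is the equalizer of two maps `S ⟶ A × A` over `A`: on `(a, y)` they are
`(a, a)` and `(a, p(y))`, for `p` the structure map of `Y`. -/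
noncomputable def regularMonoOfRetraction {A : C} {Y S : Over A} (η : Y ⟶ S) (q : S.left ⟶ Y.left)
    (hq : η.left ≫ q = 𝟙 _)
    (hS : ∀ ⦃T : C⦄ (a b : T ⟶ S.left), a ≫ q = b ≫ q → a ≫ S.hom = b ≫ S.hom → a = b) :
    RegularMono η where
  Z := Over.mk (fst A A)
  left := Over.homMk (lift S.hom S.hom)
  right := Over.homMk (lift S.hom (q ≫ Y.hom))
  w := by
    ext
    simp [reassoc_of% hq]
  isLimit := Fork.IsLimit.mk' _ fun s => by
    have h : s.ι.left ≫ lift S.hom S.hom = s.ι.left ≫ lift S.hom (q ≫ Y.hom) :=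
      congrArg CommaMorphism.left s.condition
    have h₁ : s.ι.left ≫ q ≫ Y.hom = s.pt.hom := by
      rw [← Over.w s.ι]
      simpa using (h =≫ snd _ _).symm
    refine ⟨Over.homMk (s.ι.left ≫ q) (by simpa using h₁), ?_, fun {m} hm => ?_⟩
    · apply Over.OverMorphism.ext
      apply hS
      · simp [hq]
      · simp [h₁]
    · apply Over.OverMorphism.ext
      have hm : m ≫ η = s.ι := hm
      simp [← hm, hq]

/-- The units `Y ⟶ A × Y` of the adjunction between the forgetful functor of the slice over `A` and
`Y ↦ A × Y` are regular monomorphisms. -/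
noncomputable def regularMonoForgetAdjStarUnit (A : C) (Y : Over A) :
    RegularMono ((Over.forgetAdjStar A).unit.app Y) :=
  regularMonoOfRetraction _ (prod.snd : A ⨯ Y.left ⟶ Y.left)
    ((congrArg (· ≫ _) (Over.forgetAdjStar_unit_app_left A Y)).trans (prod.lift_snd _ _))
    fun T a b h₁ h₂ => by
      have hs : ((Over.star A).obj Y.left).hom = prod.fst := prod.lift_fst _ _
      refine Limits.prod.hom_ext ?_ h₁
      exact (congrArg (a ≫ ·) hs).symm.trans (h₂.trans (congrArg (b ≫ ·) hs))

/-- To be exponentiable it suffices that dependent products of the constant families `A × X` exist: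
the dependent product of `Y` over `A` is then an equalizer of those of `A × Y` and `A × A × Y`. -/
theorem isExponentiable_of_comp_forget {A B : C} (f : A ⟶ B)
    [(Over.pullback f ⋙ Over.forget A).IsLeftAdjoint] : IsExponentiable f :=
  isLeftAdjoint_triangle_lift (Over.pullback f) (Over.forgetAdjStar A)
    (regularMonoForgetAdjStarUnit A)

variable [FinitaryExtensive C]

theorem isExponentiable_projE (L : ∀ X : C, ListObject X) (N : NaturalNumbersObject C) :
    IsExponentiable N.projE :=
  haveI := (pullbackForgetAdj L N).isLeftAdjoint
  isExponentiable_of_comp_forget N.projE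

variable (L : ∀ X : C, ListObject X) (N : NaturalNumbersObject C)

/-- The list object functor over `N` is pullback to `E` followed by the dependent product along
`E ⟶ N`: both are right adjoint to `Z ↦ Z ×_N E`. -/
noncomputable def overTerminalIso (h : IsExponentiable N.projE) :
    (overTerminal C).functor ⋙ lengthFunctor L N ≅
      Over.pullback (toUnit N.E) ⋙ dependentProduct N.projE h :=
  haveI : (Over.pullback N.projE).IsLeftAdjoint := h
  Adjunction.rightAdjointUniq
    ((pullbackForgetAdj L N).comp (overTerminal C).symm.toAdjunction)
    (((Adjunction.ofIsLeftAdjoint (Over.pullback N.projE)).comp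
      (Over.mapPullbackAdj (toUnit N.E))).ofNatIsoLeft
      (NatIso.ofComponents (fun _ => Over.isoMk (Iso.refl _) (toUnit_unique _ _))
        fun _ => Over.OverMorphism.ext ((Category.comp_id _).trans (Category.id_comp _).symm)))

theorem listPolynomial_representsEndofunctor :
    (listPolynomial N).RepresentsEndofunctor (listFunctor L) :=
  ⟨isExponentiable_projE L N, ⟨by
    refine ?_ ≪≫ Functor.isoWhiskerRight (overTerminalIso L N (isExponentiable_projE L N))
      (Over.map (toUnit N.obj))
    exact NatIso.ofComponents (fun _ => Over.isoMk (Iso.refl _) (toUnit_unique _ _))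
      fun _ => Over.OverMorphism.ext ((Category.comp_id _).trans (Category.id_comp _).symm)⟩⟩

end LocosPoly

theorem mainTheorem1 {C : Type u} [Category.{v} C] [CartesianMonoidalCategory C] [HasFiniteLimits C]
    [FinitaryExtensive C]
    (L : ∀ X : C, LocosPoly.ListObject X) :
    LocosPoly.IsPolynomialEndofunctor (LocosPoly.listFunctor L) ∧
    (LocosPoly.listPolynomial (L (𝟙_ C)).toNaturalNumbersObject).RepresentsEndofunctor
      (LocosPoly.listFunctor L) ∧
    LocosPoly.IsExponentiable (L (𝟙_ C)).toNaturalNumbersObject.projE := by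
  have h := LocosPoly.listPolynomial_representsEndofunctor L (L (𝟙_ C)).toNaturalNumbersObject
  exact ⟨⟨_, h⟩, h, h.1⟩
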